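/- Let $\mathbb G$ be a homogeneous Lie group of dimension $n\ge 1$: a Lie group with global smooth coordinates $\mathbb G\cong\mathbb R^n$ and weights $w_1,\dots,w_n>0$ such that for every $r>0$ the dilation $\delta_r$, given in coordinates by $(t_1,\dots,t_n)\mapsto(r^{w_1}t_1,\dots,r^{w_n}t_n)$, respects the group law. Let $Q=w_1+\dots+w_n$ be its homogeneous dimension, $dx$ a Haar measure, and $|\cdot|$ a homogeneous quasi-norm, that is, a continuous function $\mathbb G\to[0,\infty)$ with $|x^{-1}|=|x|$, $|\delta_r x|=r|x|$ for $r>0$, and $|x|=0$ only for $x$ the identity. Put $B(0,r)=\{y\in\mathbb G:|y|<r\}$ and $$H_2^B(f_1,f_2)(x)=\int_{B(0,|x|)}f_1(y)\,dy\cdot\int_{B(0,|x|)}f_2(y)\,dy .$$ Let $1<p_1,p_2\le q<\infty$, let $\alpha,\beta_1,\beta_2\in\mathbb R$, and put $p_i'=p_i/(p_i-1)$. Then there is a constant $C<\infty$ such that $$\left(\int_{\mathbb G}\left|H_2^B(f_1,f_2)(x)\right|^q|x|^\alpha\,dx\right)^{1/q}\le C\left(\int_{\mathbb G}|f_1(x)|^{p_1}|x|^{\beta_1}\,dx\right)^{1/p_1}\left(\int_{\mathbb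 G}|f_2(x)|^{p_2}|x|^{\beta_2}\,dx\right)^{1/p_2}$$ for all measurable functions $f_1,f_2:\mathbb G\to\mathbb C$ if and only if $$\alpha+Q<0,\qquad \beta_1(1-p_1')+Q>0,\qquad \beta_2(1-p_2')+Q>0$$ and $$\frac{\alpha+Q}{q}+\frac{\beta_1(1-p_1')+Q}{p_1'}+\frac{\beta_2(1-p_2')+Q}{p_2'}=0 .$$ (In the inequality an integral of a complex function over a ball is taken to be $0$ if the function is not integrable there, and $0\cdot\infty=0$ on the right.) Moreover, for $i=1,2$, if $\beta_i(1-p_i')+Q>0$, then every measurable $f:\mathbb G\to\mathbb C$ with $\int_{\mathbb G}|f(x)|^{p_i}|x|^{\beta_i}\,dx<\infty$ is integrable on every ball $B(0,r)$, so that under the above conditions the integrals defining $H_2^B(f_1,f_2)$ converge absolutely whenever the right-hand side is made of finite factors. -/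

import Mathlib

open MeasureTheory
open scoped NNReal ENNReal Manifold ContDiff

noncomputable section

/-- A homogeneous structure on a Lie group `G` of dimension `n`: global smooth coordinates
`G ≅ ℝⁿ` and positive weights `w₁, …, wₙ` such that, in these coordinates, the dilations
`(t₁, …, tₙ) ↦ (r ^ w₁ * t₁, …, r ^ wₙ * tₙ)`, `r > 0`, respect the group law.
A Lie group with such a structure is a homogeneous Lie group. -/
structure HomogeneousStructure (n : ℕ) (G : Type*) [Group G] [TopologicalSpace G]
    [ChartedSpace (EuclideanSpace ℝ (Fin n)) G] where
  /-- the global coordinates -/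
  coord : Diffeomorph 𝓘(ℝ, EuclideanSpace ℝ (Fin n)) 𝓘(ℝ, EuclideanSpace ℝ (Fin n))
    G (EuclideanSpace ℝ (Fin n)) ∞
  /-- the dilation weights -/
  weight : Fin n → ℝ
  weight_pos : ∀ i, 0 < weight i
  dilation_mul : ∀ r : ℝ, 0 < r → ∀ x y : G,
    coord.symm (WithLp.toLp 2 fun i => r ^ weight i * coord (x * y) i) =
      coord.symm (WithLp.toLp 2 fun i => r ^ weight i * coord x i) *
        coord.symm (WithLp.toLp 2 fun i => r ^ weight i * coord y i)

namespace HomogeneousStructure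

variable {n : ℕ} {G : Type*} [Group G] [TopologicalSpace G]
  [ChartedSpace (EuclideanSpace ℝ (Fin n)) G]

/-- The dilation of `G` by the factor `r` (used for `r > 0` only). -/
def dilation (S : HomogeneousStructure n G) (r : ℝ) (x : G) : G :=
  S.coord.symm (WithLp.toLp 2 fun i => r ^ S.weight i * S.coord x i)

/-- The homogeneous dimension: the sum of the dilation weights. -/
def homogeneousDim (S : HomogeneousStructure n G) : ℝ := ∑ i, S.weight i

/-- A homogeneous quasi-norm on `G`: a continuous nonnegative function, symmetric,
homogeneous of degree one for the dilations, and vanishing exactly at the identity. -/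
structure QuasiNorm (S : HomogeneousStructure n G) where
  /-- the value `|x|` of the quasi-norm -/
  val : G → ℝ
  continuous_val : Continuous val
  nonneg : ∀ x, 0 ≤ val x
  symmetric : ∀ x, val x⁻¹ = val x
  homogeneous : ∀ r : ℝ, 0 < r → ∀ x, val (S.dilation r x) = r * val x
  definite : ∀ x, val x = 0 ↔ x = 1

namespace QuasiNorm

variable {S : HomogeneousStructure n G}

/-- The open quasi-ball of radius `r` centred at the identity. -/
def ball (N : S.QuasiNorm) (r : ℝ) : Set G := {y | N.val y < r}

/-- The bilinear Hardy operator
`H₂ᴮ(f₁, f₂)(x) = (∫_{B(0,|x|)} f₁) * (∫_{B(0,|x|)} f₂)`. -/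
def bilinearHardy [MeasurableSpace G] (N : S.QuasiNorm) (μ : Measure G) (f₁ f₂ : G → ℂ)
    (x : G) : ℂ :=
  (∫ y in N.ball (N.val x), f₁ y ∂μ) * (∫ y in N.ball (N.val x), f₂ y ∂μ)

/-- The weighted norm `(∫ |f(x)| ^ p * |x| ^ γ dx) ^ (1 / p)`, with values in `[0, ∞]`. -/
def weightedNorm [MeasurableSpace G] (N : S.QuasiNorm) (μ : Measure G) (p γ : ℝ)
    (f : G → ℂ) : ℝ≥0∞ :=
  (∫⁻ x, ‖f x‖ₑ ^ p * ENNReal.ofReal (N.val x ^ γ) ∂μ) ^ (1 / p)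

end QuasiNorm

end HomogeneousStructure

end

/-! Only the radius `|x|` matters. The image of Haar measure under `|·|` has density `κ r ^ (Q - 1)`
on `(0, ∞)`, so integrals of powers of the radius over balls, shells and exteriors of balls are
explicit. This rests on the scaling `μ (B(0, r)) = r ^ Q * μ (B(0, 1))`, which holds because Haar
measure is a multiple of Lebesgue measure in the coordinates (`det_translationDeriv`).

Write `Dᵢ = βᵢ (1 - pᵢ') + Q`, `Fᵢ(R) = ∫_{B(0,R)} |fᵢ|`, and `Nᵢ` for the weighted norm of `fᵢ`.

Sufficiency: Hölder gives `Fᵢ(R) ≤ Kᵢ Nᵢ R ^ (Dᵢ / pᵢ')`. In `(F₁ F₂) ^ q = F₁ ^ (q - p₁) * F₁ ^ p₁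
* F₂ ^ q` the first and last factors are bounded this way; by the balance condition the powers of
`|x|` then add up to the weight of the linear Hardy inequality for `F₁` in `L ^ p₁`
(`exists_hardy`).

Necessity: the test functions `|x| ^ (βᵢ (1 - pᵢ'))`, cut off to subsets of `B(0, R)`, are extremal
for Hölder (`HardyBound.test`). Shells force `α + Q < 0`, shells exhausting a ball force `Dᵢ > 0`,
and full balls then give `k R ^ E ≤ C` for all `R`, where `E` is the left side of the balance
condition, so `E = 0`. -/

section

open Set Filter Topology

/-- The diagonal linear map with entries `r ^ w i`. -/
noncomputable def diagonalDilation {n : ℕ} (w : Fin n → ℝ) (r : ℝ) :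
    EuclideanSpace ℝ (Fin n) →L[ℝ] EuclideanSpace ℝ (Fin n) :=
  Matrix.toEuclideanCLM (𝕜 := ℝ) (Matrix.diagonal fun i => r ^ w i)

/-! ### Dilations in coordinates -/

section diagonalDilation

variable {n : ℕ} (w : Fin n → ℝ)

theorem diagonalDilation_eq (r : ℝ) (t : EuclideanSpace ℝ (Fin n)) :
    diagonalDilation w r t = WithLp.toLp 2 fun i => r ^ w i * t i := by
  ext i
  simp [diagonalDilation, Matrix.ofLp_toEuclideanCLM, Matrix.mulVec_diagonal]

@[simp]
theorem diagonalDilation_apply (r : ℝ) (t : EuclideanSpace ℝ (Fin n)) (i : Fin n) :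
    diagonalDilation w r t i = r ^ w i * t i := by
  rw [diagonalDilation_eq]

theorem det_diagonalDilation {r : ℝ} (hr : 0 < r) :
    LinearMap.det (diagonalDilation w r : EuclideanSpace ℝ (Fin n) →ₗ[ℝ] _) =
      r ^ ∑ i, w i := by
  have h : (diagonalDilation w r : EuclideanSpace ℝ (Fin n) →ₗ[ℝ] _) =
      Matrix.toLin (EuclideanSpace.basisFun (Fin n) ℝ).toBasis
        (EuclideanSpace.basisFun (Fin n) ℝ).toBasis (Matrix.diagonal fun i => r ^ w i) := by
    rw [diagonalDilation, Matrix.coe_toEuclideanCLM_eq_toEuclideanLin,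
      Matrix.toEuclideanLin_eq_toLin_orthonormal]
  rw [h, LinearMap.det_toLin, Matrix.det_diagonal, Real.rpow_sum_of_pos hr]

theorem det_diagonalDilation_pos {r : ℝ} (hr : 0 < r) :
    0 < LinearMap.det (diagonalDilation w r : EuclideanSpace ℝ (Fin n) →ₗ[ℝ] _) := by
  rw [det_diagonalDilation w hr]
  positivity

theorem diagonalDilation_one (t : EuclideanSpace ℝ (Fin n)) : diagonalDilation w 1 t = t := by
  ext i
  simp

theorem continuous_diagonalDilation (hw : ∀ i, 0 < w i) (t : EuclideanSpace ℝ (Fin n)) :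
    Continuous fun r : ℝ => diagonalDilation w r t := by
  simp only [diagonalDilation_eq]
  refine (PiLp.continuous_toLp 2 _).comp (continuous_pi fun i => ?_)
  exact (continuous_id.rpow_const fun _ => Or.inr (hw i).le).mul continuous_const

theorem diagonalDilation_zero (hw : ∀ i, 0 < w i) (t : EuclideanSpace ℝ (Fin n)) :
    diagonalDilation w 0 t = 0 := by
  ext i
  simp [Real.zero_rpow (hw i).ne']

end diagonalDilation

/-! ### Haar measure in the global coordinates -/

namespace HomogeneousStructure

variable {n : ℕ} {G : Type*} [Group G] [TopologicalSpace G]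
  [ChartedSpace (EuclideanSpace ℝ (Fin n)) G] (S : HomogeneousStructure n G)

/-- The group law of a homogeneous group in the global coordinates. -/
noncomputable def coordMul (u v : EuclideanSpace ℝ (Fin n)) : EuclideanSpace ℝ (Fin n) :=
  S.coord (S.coord.symm u * S.coord.symm v)

theorem coord_dilation (r : ℝ) (x : G) :
    S.coord (S.dilation r x) = diagonalDilation S.weight r (S.coord x) := by
  rw [dilation, diagonalDilation_eq]
  exact S.coord.apply_symm_apply _

theorem diagonalDilation_coordMul {r : ℝ} (hr : 0 < r) (u v : EuclideanSpace ℝ (Fin n)) :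
    diagonalDilation S.weight r (S.coordMul u v) =
      S.coordMul (diagonalDilation S.weight r u) (diagonalDilation S.weight r v) := by
  have h := congrArg S.coord (S.dilation_mul r hr (S.coord.symm u) (S.coord.symm v))
  simpa [coordMul, diagonalDilation_eq] using h

theorem dilation_map_mul {r : ℝ} (hr : 0 < r) (x y : G) :
    S.dilation r (x * y) = S.dilation r x * S.dilation r y :=
  S.dilation_mul r hr x y

/-- Being multiplicative, `dilation 2` fixes the identity, yet it multiplies each coordinate by a
factor `2 ^ w i > 1`. -/
theorem coord_one : S.coord (1 : G) = 0 := by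
  have h1 : S.dilation 2 (1 : G) = 1 := by
    have := S.dilation_map_mul two_pos (1 : G) 1
    rw [mul_one] at this
    exact left_eq_mul.mp this
  have h2 := S.coord_dilation 2 (1 : G)
  rw [h1] at h2
  ext i
  have h3 : S.coord (1 : G) i = 2 ^ S.weight i * S.coord (1 : G) i := by
    conv_lhs => rw [h2]
    simp
  have h4 : (1 : ℝ) < 2 ^ S.weight i := Real.one_lt_rpow one_lt_two (S.weight_pos i)
  have h5 : (2 ^ S.weight i - 1) * S.coord (1 : G) i = 0 := by linarith
  simpa using (mul_eq_zero.mp h5).resolve_left (by linarith)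

theorem coord_symm_zero : S.coord.symm 0 = (1 : G) := by
  rw [← S.coord_one]
  exact S.coord.symm_apply_apply _

theorem coordMul_zero_left (v : EuclideanSpace ℝ (Fin n)) : S.coordMul 0 v = v := by
  simp [coordMul, coord_symm_zero]

theorem coordMul_injective (u : EuclideanSpace ℝ (Fin n)) :
    Function.Injective (S.coordMul u) := fun _ _ h =>
  S.coord.symm.injective (mul_left_cancel (S.coord.injective h))

theorem contDiff_coordMul [LieGroup 𝓘(ℝ, EuclideanSpace ℝ (Fin n)) ∞ G] :
    ContDiff ℝ ∞ fun z : EuclideanSpace ℝ (Fin n) × EuclideanSpace ℝ (Fin n) =>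
      S.coordMul z.1 z.2 := by
  rw [← contMDiff_iff_contDiff]
  have h1 := S.coord.symm.contMDiff.comp (contDiff_fst (𝕜 := ℝ) (n := ∞)
    (E := EuclideanSpace ℝ (Fin n)) (F := EuclideanSpace ℝ (Fin n))).contMDiff
  have h2 := S.coord.symm.contMDiff.comp (contDiff_snd (𝕜 := ℝ) (n := ∞)
    (E := EuclideanSpace ℝ (Fin n)) (F := EuclideanSpace ℝ (Fin n))).contMDiff
  exact S.coord.contMDiff.comp (h1.mul h2)

/-- The derivative of left translation in the global coordinates. -/
noncomputable def translationDeriv (z : EuclideanSpace ℝ (Fin n) × EuclideanSpace ℝ (Fin n)) :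
    EuclideanSpace ℝ (Fin n) →L[ℝ] EuclideanSpace ℝ (Fin n) :=
  (fderiv ℝ (fun z : EuclideanSpace ℝ (Fin n) × EuclideanSpace ℝ (Fin n) =>
    S.coordMul z.1 z.2) z).comp (ContinuousLinearMap.inr ℝ _ _)

section lebesgue

variable [MeasurableSpace G] [BorelSpace G]

/-- The image of Lebesgue measure under the global coordinates. -/
noncomputable def lebesgue : Measure G := volume.map S.coord.symm

theorem lebesgue_apply {A : Set G} (hA : MeasurableSet A) :
    S.lebesgue A = volume (S.coord.symm ⁻¹' A) :=
  Measure.map_apply S.coord.symm.continuous.measurable hA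

end lebesgue

section LieGroup

variable [LieGroup 𝓘(ℝ, EuclideanSpace ℝ (Fin n)) ∞ G]

theorem hasFDerivAt_coordMul (u v : EuclideanSpace ℝ (Fin n)) :
    HasFDerivAt (S.coordMul u) (S.translationDeriv (u, v)) v :=
  ((S.contDiff_coordMul.differentiable (by simp)) (u, v)).hasFDerivAt.comp v
    (hasFDerivAt_prodMk_right u v)

theorem continuous_translationDeriv : Continuous S.translationDeriv :=
  (S.contDiff_coordMul.continuous_fderiv (by simp)).clm_comp continuous_const

/-- Differentiate `δ_r ∘ L_u = L_{δ_r u} ∘ δ_r`: the factor `det δ_r ≠ 0` appears on both sides and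
cancels. -/
theorem det_translationDeriv_dilation {r : ℝ} (hr : 0 < r) (u v : EuclideanSpace ℝ (Fin n)) :
    (S.translationDeriv (diagonalDilation S.weight r u, diagonalDilation S.weight r v)).det =
      (S.translationDeriv (u, v)).det := by
  have h1 := (diagonalDilation S.weight r).hasFDerivAt.comp v (S.hasFDerivAt_coordMul u v)
  have h2 := (S.hasFDerivAt_coordMul (diagonalDilation S.weight r u)
    (diagonalDilation S.weight r v)).comp v (diagonalDilation S.weight r).hasFDerivAt
  have h3 : (diagonalDilation S.weight r) ∘ (S.coordMul u) =
      S.coordMul (diagonalDilation S.weight r u) ∘ diagonalDilation S.weight r := by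
    funext t
    exact S.diagonalDilation_coordMul hr u t
  rw [h3] at h1
  have h4 := congrArg ContinuousLinearMap.det (h2.unique h1)
  simp only [ContinuousLinearMap.det, ContinuousLinearMap.toLinearMap_comp,
    LinearMap.det_comp] at h4
  rw [mul_comm] at h4
  exact mul_left_cancel₀ (det_diagonalDilation_pos S.weight hr).ne' h4

/-- The Jacobian is constant along `r ↦ (δ_r u, δ_r v)`, and this curve tends to `(0, 0)` as `r →
0⁺`, where translation is the identity map. -/
theorem det_translationDeriv (u v : EuclideanSpace ℝ (Fin n)) :
    (S.translationDeriv (u, v)).det = 1 := by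
  have h0 : (S.translationDeriv (0, 0)).det = 1 := by
    have h1 := S.hasFDerivAt_coordMul 0 0
    have h2 : S.coordMul 0 = id := funext S.coordMul_zero_left
    rw [h2] at h1
    rw [h1.unique (hasFDerivAt_id 0)]
    simp [ContinuousLinearMap.det]
  have hc : Continuous fun r : ℝ => (S.translationDeriv
      (diagonalDilation S.weight r u, diagonalDilation S.weight r v)).det :=
    ContinuousLinearMap.continuous_det.comp (S.continuous_translationDeriv.comp
      ((continuous_diagonalDilation S.weight S.weight_pos u).prodMk
        (continuous_diagonalDilation S.weight S.weight_pos v)))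
  have h1 : Tendsto (fun r : ℝ => (S.translationDeriv
      (diagonalDilation S.weight r u, diagonalDilation S.weight r v)).det) (𝓝[>] 0) (𝓝 1) := by
    have := (hc.tendsto 0).mono_left (nhdsWithin_le_nhds (s := Ioi 0))
    simpa only [diagonalDilation_zero _ S.weight_pos, h0] using this
  refine tendsto_nhds_unique (tendsto_const_nhds.congr' ?_) h1
  filter_upwards [self_mem_nhdsWithin] with r hr
  exact (S.det_translationDeriv_dilation hr u v).symm

theorem volume_preimage_coordMul (u : EuclideanSpace ℝ (Fin n))
    {A : Set (EuclideanSpace ℝ (Fin n))} (hA : MeasurableSet A) :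
    volume (S.coordMul u ⁻¹' A) = volume A := by
  have hcont : Continuous (S.coordMul u) :=
    continuous_iff_continuousAt.2 fun v => (S.hasFDerivAt_coordMul u v).continuousAt
  have h := lintegral_abs_det_fderiv_eq_addHaar_image volume (hcont.measurable hA)
    (fun v _ => (S.hasFDerivAt_coordMul u v).hasFDerivWithinAt) (S.coordMul_injective u).injOn
  have hsurj : Function.Surjective (S.coordMul u) := fun v =>
    ⟨S.coord ((S.coord.symm u)⁻¹ * S.coord.symm v), by simp [coordMul]⟩
  rw [image_preimage_eq _ hsurj] at h
  simpa [det_translationDeriv] using h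

variable [MeasurableSpace G] [BorelSpace G]

theorem isMulLeftInvariant_lebesgue : S.lebesgue.IsMulLeftInvariant := by
  have : IsTopologicalGroup G :=
    topologicalGroup_of_lieGroup 𝓘(ℝ, EuclideanSpace ℝ (Fin n)) ∞
  refine ⟨fun g => ?_⟩
  ext A hA
  have hm : Measurable (g * ·) := (continuous_const_mul g).measurable
  rw [Measure.map_apply hm hA, S.lebesgue_apply (hm hA), S.lebesgue_apply hA,
    ← S.volume_preimage_coordMul (S.coord g) (S.coord.symm.continuous.measurable hA)]
  congr 1
  ext v
  simp [coordMul]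

theorem isHaarMeasure_lebesgue : S.lebesgue.IsHaarMeasure := by
  have := S.isMulLeftInvariant_lebesgue
  refine { lt_top_of_isCompact := fun K hK => ?_, open_pos := fun U hU hU0 => ?_ }
  · have : T2Space G := S.coord.toHomeomorph.isEmbedding.t2Space
    rw [S.lebesgue_apply hK.isClosed.measurableSet]
    exact (S.coord.symm.toHomeomorph.isCompact_preimage.2 hK).measure_lt_top
  · rw [S.lebesgue_apply hU.measurableSet]
    exact ((hU.preimage S.coord.symm.continuous).measure_pos volume
      (hU0.preimage S.coord.symm.surjective)).ne'

theorem exists_eq_smul_lebesgue (μ : Measure G) [μ.IsHaarMeasure] :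
    ∃ c : ℝ≥0, μ = c • S.lebesgue := by
  have : IsTopologicalGroup G :=
    topologicalGroup_of_lieGroup 𝓘(ℝ, EuclideanSpace ℝ (Fin n)) ∞
  have : SecondCountableTopology G := S.coord.toHomeomorph.secondCountableTopology
  have : LocallyCompactSpace G := S.coord.toHomeomorph.isClosedEmbedding.locallyCompactSpace
  have := S.isHaarMeasure_lebesgue
  exact ⟨_, Measure.isMulLeftInvariant_eq_smul μ S.lebesgue⟩

theorem measure_preimage_dilation (μ : Measure G) [μ.IsHaarMeasure] {r : ℝ} (hr : 0 < r)
    {A : Set G} (hA : MeasurableSet A) :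
    μ (S.dilation r ⁻¹' A) = ENNReal.ofReal (r ^ (-S.homogeneousDim)) * μ A := by
  obtain ⟨c, hc⟩ := S.exists_eq_smul_lebesgue μ
  have hcont : Continuous (S.dilation r) := by
    have : S.dilation r = S.coord.symm ∘ diagonalDilation S.weight r ∘ S.coord := by
      funext x
      simp [← coord_dilation]
    rw [this]
    exact S.coord.symm.continuous.comp
      ((diagonalDilation S.weight r).continuous.comp S.coord.continuous)
  have h := Measure.addHaar_preimage_linearMap volume
    (det_diagonalDilation_pos S.weight hr).ne' (S.coord.symm ⁻¹' A)
  rw [det_diagonalDilation S.weight hr, ← Real.rpow_neg hr.le, abs_of_nonneg (by positivity)] at h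
  have h2 : S.coord.symm ⁻¹' (S.dilation r ⁻¹' A) =
      (diagonalDilation S.weight r : EuclideanSpace ℝ (Fin n) →ₗ[ℝ] _) ⁻¹'
        (S.coord.symm ⁻¹' A) := by
    ext v
    simp [dilation, diagonalDilation_eq]
  rw [hc, Measure.smul_apply, Measure.smul_apply, S.lebesgue_apply (hcont.measurable hA),
    S.lebesgue_apply hA, h2, h, homogeneousDim]
  simp only [ENNReal.smul_def, smul_eq_mul]
  ring

end LieGroup

/-! ### Volume of quasi-balls -/

namespace QuasiNorm

variable {S} (N : S.QuasiNorm)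

theorem val_one : N.val 1 = 0 := (N.definite 1).2 rfl

/-- Take `m` to be a positive lower bound of the quasi-norm on the compact coordinate unit sphere. A
point outside the coordinate unit ball is moved onto the sphere by some dilation with `r ≤ 1`, so
its quasi-norm is at least `m`. -/
theorem exists_ball_subset : ∃ m > 0, N.ball m ⊆ S.coord ⁻¹' Metric.closedBall 0 1 := by
  obtain ⟨m, hm, h⟩ := (isCompact_sphere (0 : EuclideanSpace ℝ (Fin n)) 1).exists_forall_le'
    (N.continuous_val.comp S.coord.symm.continuous).continuousOn (a := 0) (by
      intro t ht
      refine (N.nonneg _).lt_of_ne' fun h0 => ?_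
      have h1 : S.coord.symm t = 1 := (N.definite _).1 h0
      have h2 : t = 0 := by rw [← S.coord_one, ← h1]; simp
      simp [h2] at ht)
  refine ⟨m, hm, fun x hx => ?_⟩
  by_contra hx1
  simp only [mem_preimage, Metric.mem_closedBall, dist_zero_right, not_le] at hx1
  have hc : Continuous fun r : ℝ => ‖diagonalDilation S.weight r (S.coord x)‖ :=
    (continuous_diagonalDilation S.weight S.weight_pos _).norm
  obtain ⟨r, hr, hr1⟩ := intermediate_value_Icc zero_le_one hc.continuousOn
    (show (1 : ℝ) ∈ _ by
      simp [diagonalDilation_zero _ S.weight_pos, diagonalDilation_one, hx1.le])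
  have hr0 : 0 < r := by
    refine hr.1.lt_of_ne ?_
    rintro rfl
    simp [diagonalDilation_zero _ S.weight_pos] at hr1
  have h3 := h (S.coord (S.dilation r x)) (by simpa [coord_dilation] using hr1)
  simp only [Function.comp_apply, Diffeomorph.symm_apply_apply, N.homogeneous r hr0] at h3
  have hx2 : N.val x < m := hx
  nlinarith [hr.2, N.nonneg x]

theorem preimage_dilation_ball {r : ℝ} (hr : 0 < r) (R : ℝ) :
    S.dilation r ⁻¹' N.ball (r * R) = N.ball R := by
  ext x
  simp [ball, N.homogeneous r hr, hr]

theorem isOpen_ball (r : ℝ) : IsOpen (N.ball r) := isOpen_lt N.continuous_val continuous_const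

theorem measure_ball_pos [MeasurableSpace G] (μ : Measure G) [μ.IsHaarMeasure] {r : ℝ}
    (hr : 0 < r) : 0 < μ (N.ball r) :=
  (N.isOpen_ball r).measure_pos μ ⟨1, by simpa [ball, val_one] using hr⟩

variable [LieGroup 𝓘(ℝ, EuclideanSpace ℝ (Fin n)) ∞ G] [MeasurableSpace G] [BorelSpace G]
  (μ : Measure G) [μ.IsHaarMeasure]

theorem measure_ball_mul {r : ℝ} (hr : 0 < r) (R : ℝ) :
    μ (N.ball (r * R)) = ENNReal.ofReal (r ^ S.homogeneousDim) * μ (N.ball R) := by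
  have h := S.measure_preimage_dilation μ hr (N.isOpen_ball (r * R)).measurableSet
  rw [N.preimage_dilation_ball hr] at h
  rw [h, ← mul_assoc, ← ENNReal.ofReal_mul (by positivity), ← Real.rpow_add hr]
  simp

theorem measure_ball_ne_top (r : ℝ) : μ (N.ball r) ≠ ⊤ := by
  obtain ⟨m, hm, h⟩ := N.exists_ball_subset
  have h1 : μ (N.ball m) ≠ ⊤ := by
    refine ne_top_of_le_ne_top (IsCompact.measure_lt_top ?_).ne (measure_mono h)
    exact S.coord.toHomeomorph.isCompact_preimage.2 (isCompact_closedBall 0 1)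
  rcases le_or_gt r 0 with hr | hr
  · refine ne_top_of_le_ne_top h1 (measure_mono fun x (hx : N.val x < r) => ?_)
    exact hx.trans_le (hr.trans hm.le)
  · have := N.measure_ball_mul μ (div_pos hr hm) m
    rw [div_mul_cancel₀ _ hm.ne'] at this
    rw [this]
    exact ENNReal.mul_ne_top ENNReal.ofReal_ne_top h1

end QuasiNorm

end HomogeneousStructure

/-! ### Power integrals on the half-line -/

theorem lintegral_Ioo_rpow {s R : ℝ} (hs : -1 < s) (hR : 0 < R) :
    ∫⁻ r in Ioo 0 R, ENNReal.ofReal (r ^ s) = ENNReal.ofReal (R ^ (s + 1) / (s + 1)) := by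
  rw [← ofReal_integral_eq_lintegral_ofReal
    ((intervalIntegral.integrableOn_Ioo_rpow_iff hR).2 hs)]
  · rw [← integral_Ioc_eq_integral_Ioo, ← intervalIntegral.integral_of_le hR.le,
      integral_rpow (Or.inl hs), Real.zero_rpow (by linarith), sub_zero]
  · filter_upwards [ae_restrict_mem measurableSet_Ioo] with r hr
    exact Real.rpow_nonneg hr.1.le s

theorem lintegral_Ioi_rpow {s R : ℝ} (hs : s < -1) (hR : 0 < R) :
    ∫⁻ r in Ioi R, ENNReal.ofReal (r ^ s) = ENNReal.ofReal (-R ^ (s + 1) / (s + 1)) := by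
  rw [← ofReal_integral_eq_lintegral_ofReal (integrableOn_Ioi_rpow_of_lt hs hR),
    integral_Ioi_rpow_of_lt hs hR]
  filter_upwards [ae_restrict_mem measurableSet_Ioi] with r hr
  exact Real.rpow_nonneg (hR.trans hr).le s

theorem integrableOn_rpow_of_lintegral_ne_top {s : ℝ} {A : Set ℝ} (hA : MeasurableSet A)
    (hA0 : A ⊆ Ioi 0) (h : ∫⁻ r in A, ENNReal.ofReal (r ^ s) ≠ ⊤) :
    IntegrableOn (fun r : ℝ => r ^ s) A := by
  refine (lintegral_ofReal_ne_top_iff_integrable (by fun_prop) ?_).1 h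
  filter_upwards [ae_restrict_mem hA] with r hr
  exact Real.rpow_nonneg (hA0 hr).le s

theorem eq_zero_of_forall_rpow_le {E M : ℝ} (h : ∀ R : ℝ, 0 < R → R ^ E ≤ M) : E = 0 := by
  have key : ∀ {E : ℝ}, (∀ R : ℝ, 0 < R → R ^ E ≤ M) → E ≤ 0 := by
    intro E h
    by_contra! hE
    obtain ⟨R, hR, hR0⟩ :=
      (((tendsto_rpow_atTop hE).eventually_gt_atTop M).and (eventually_gt_atTop 0)).exists
    exact (h R hR0).not_gt hR
  refine le_antisymm (key h) (neg_nonpos.1 (key fun R hR => ?_))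
  rw [Real.rpow_neg hR.le, ← Real.inv_rpow hR.le]
  exact h _ (inv_pos.2 hR)

/-- The function `ρ` has the distribution of the radius in a space of homogeneous
dimension `Q`: the image of `μ` under `ρ` has density `κ * r ^ (Q - 1)` on `(0, ∞)`. -/
structure IsPolar {X : Type*} [MeasurableSpace X] (μ : Measure X) (ρ : X → ℝ) (Q κ : ℝ) :
    Prop where
  measurable : Measurable ρ
  dim_pos : 0 < Q
  const_pos : 0 < κ
  map_eq : μ.map ρ =
    (volume.restrict (Ioi 0)).withDensity fun r => ENNReal.ofReal (κ * r ^ (Q - 1))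

/-! ### Power integrals of the radius -/

namespace IsPolar

variable {X : Type*} [MeasurableSpace X] {μ : Measure X} {ρ : X → ℝ} {Q κ : ℝ}

theorem ae_pos (h : IsPolar μ ρ Q κ) : ∀ᵐ x ∂μ, 0 < ρ x := by
  have h1 : ∀ᵐ r ∂μ.map ρ, 0 < r := by
    rw [h.map_eq]
    exact (withDensity_absolutelyContinuous _ _).ae_le (ae_restrict_mem measurableSet_Ioi)
  exact ae_of_ae_map h.measurable.aemeasurable h1

theorem setLIntegral_rpow (h : IsPolar μ ρ Q κ) {A : Set ℝ} (hA : MeasurableSet A) (a : ℝ) :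
    ∫⁻ x in ρ ⁻¹' A, ENNReal.ofReal (ρ x ^ a) ∂μ =
      ENNReal.ofReal κ * ∫⁻ r in A ∩ Ioi 0, ENNReal.ofReal (r ^ (a + Q - 1)) := by
  rw [← setLIntegral_map (f := fun r => ENNReal.ofReal (r ^ a)) hA (by fun_prop) h.measurable,
    h.map_eq, setLIntegral_withDensity_eq_setLIntegral_mul _ (by fun_prop) (by fun_prop) hA,
    Measure.restrict_restrict hA, ← lintegral_const_mul _ (by fun_prop)]
  refine setLIntegral_congr_fun (hA.inter measurableSet_Ioi) fun r hr => ?_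
  have hr0 : (0 : ℝ) < r := hr.2
  simp only [Pi.mul_apply]
  rw [← ENNReal.ofReal_mul (mul_nonneg h.const_pos.le (by positivity)),
    ← ENNReal.ofReal_mul h.const_pos.le, mul_assoc, ← Real.rpow_add hr0]
  ring_nf

theorem setLIntegral_lt_rpow (h : IsPolar μ ρ Q κ) {a R : ℝ} (ha : 0 < a + Q) (hR : 0 < R) :
    ∫⁻ x in {x | ρ x < R}, ENNReal.ofReal (ρ x ^ a) ∂μ =
      ENNReal.ofReal (κ / (a + Q) * R ^ (a + Q)) := by
  have := h.setLIntegral_rpow measurableSet_Iio a (A := Iio R)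
  rw [inter_comm, Ioi_inter_Iio, lintegral_Ioo_rpow (by linarith) hR,
    ← ENNReal.ofReal_mul h.const_pos.le] at this
  refine this.trans ?_
  rw [sub_add_cancel]
  ring_nf

theorem setLIntegral_gt_rpow (h : IsPolar μ ρ Q κ) {a R : ℝ} (ha : a + Q < 0) (hR : 0 < R) :
    ∫⁻ x in {x | R < ρ x}, ENNReal.ofReal (ρ x ^ a) ∂μ =
      ENNReal.ofReal (κ / -(a + Q) * R ^ (a + Q)) := by
  have := h.setLIntegral_rpow measurableSet_Ioi a (A := Ioi R)
  rw [inter_eq_left.2 (Ioi_subset_Ioi hR.le), lintegral_Ioi_rpow (by linarith) hR,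
    ← ENNReal.ofReal_mul h.const_pos.le] at this
  refine this.trans ?_
  rw [sub_add_cancel, div_neg, neg_div]
  ring_nf

theorem pos_of_setLIntegral_ne_top (h : IsPolar μ ρ Q κ) {a R : ℝ} (hR : 0 < R)
    (hfin : ∫⁻ x in {x | ρ x < R}, ENNReal.ofReal (ρ x ^ a) ∂μ ≠ ⊤) : 0 < a + Q := by
  have := h.setLIntegral_rpow measurableSet_Iio a (A := Iio R)
  rw [inter_comm, Ioi_inter_Iio] at this
  have h1 : ∫⁻ r in Ioo 0 R, ENNReal.ofReal (r ^ (a + Q - 1)) ≠ ⊤ := fun h1 => hfin (by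
    refine this.trans ?_
    rw [h1, ENNReal.mul_top (by simpa using h.const_pos)])
  have := (intervalIntegral.integrableOn_Ioo_rpow_iff hR).1
    (integrableOn_rpow_of_lintegral_ne_top measurableSet_Ioo Ioo_subset_Ioi_self h1)
  linarith

theorem neg_of_setLIntegral_ne_top (h : IsPolar μ ρ Q κ) {a R : ℝ} (hR : 0 < R)
    (hfin : ∫⁻ x in {x | R < ρ x}, ENNReal.ofReal (ρ x ^ a) ∂μ ≠ ⊤) : a + Q < 0 := by
  have := h.setLIntegral_rpow measurableSet_Ioi a (A := Ioi R)
  rw [inter_eq_left.2 (Ioi_subset_Ioi hR.le)] at this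
  have h1 : ∫⁻ r in Ioi R, ENNReal.ofReal (r ^ (a + Q - 1)) ≠ ⊤ := fun h1 => hfin (by
    refine this.trans ?_
    rw [h1, ENNReal.mul_top (by simpa using h.const_pos)])
  have := (integrableOn_Ioi_rpow_iff hR).1
    (integrableOn_rpow_of_lintegral_ne_top measurableSet_Ioi (Ioi_subset_Ioi hR.le) h1)
  linarith

/-- A shell avoids both `0` and `∞`, so its integral is positive and finite for every exponent.
Shells thus supply test functions before any sign condition is known. -/
theorem setLIntegral_shell_ne_zero (h : IsPolar μ ρ Q κ)
    (a : ℝ) {ε R : ℝ} (hε : 0 < ε) (hR : ε < R) :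
    ∫⁻ x in ρ ⁻¹' Ioo ε R, ENNReal.ofReal (ρ x ^ a) ∂μ ≠ 0 := by
  rw [h.setLIntegral_rpow measurableSet_Ioo]
  refine mul_ne_zero (by simpa using h.const_pos) ?_
  rw [inter_eq_left.2 (Ioo_subset_Ioi_self.trans (Ioi_subset_Ioi hε.le)), ← pos_iff_ne_zero,
    setLIntegral_pos_iff (by fun_prop)]
  rw [inter_eq_right.2]
  · simpa using hR
  · intro r hr
    have : 0 < r := hε.trans hr.1
    simp only [Function.mem_support, ne_eq, ENNReal.ofReal_eq_zero, not_le]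
    positivity

theorem setLIntegral_shell_ne_top (h : IsPolar μ ρ Q κ) (a : ℝ) {ε : ℝ} (hε : 0 < ε) (R : ℝ) :
    ∫⁻ x in ρ ⁻¹' Ioo ε R, ENNReal.ofReal (ρ x ^ a) ∂μ ≠ ⊤ := by
  rw [h.setLIntegral_rpow measurableSet_Ioo]
  refine ENNReal.mul_ne_top ENNReal.ofReal_ne_top ?_
  rw [inter_eq_left.2 (Ioo_subset_Ioi_self.trans (Ioi_subset_Ioi hε.le))]
  have h1 : IntegrableOn (fun r : ℝ => r ^ (a + Q - 1)) (Ioo ε R) := by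
    refine (ContinuousOn.integrableOn_Icc fun r hr => ?_).mono_set Ioo_subset_Icc_self
    exact (Real.continuousAt_rpow_const _ _ (Or.inl (hε.trans_le hr.1).ne')).continuousWithinAt
  exact h1.lintegral_lt_top.ne

/-! ### Sufficiency: Hardy inequalities -/

/-- Hölder for `(g ρ ^ s) * ρ ^ (-s)`. The exponent `s` stays free: `s = β / p` gives the growth
bound on balls, a different `s` the Hardy inequality. -/
theorem setLIntegral_le_weighted (h : IsPolar μ ρ Q κ)
    {p p' : ℝ} (hp : p.HolderConjugate p') {s R : ℝ}
    (hs : 0 < Q - s * p') (hR : 0 < R) {g : X → ℝ≥0∞} (hg : Measurable g) :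
    ∫⁻ x in {x | ρ x < R}, g x ∂μ ≤
      (∫⁻ x in {x | ρ x < R}, g x ^ p * ENNReal.ofReal (ρ x ^ (s * p)) ∂μ) ^ (1 / p) *
        ENNReal.ofReal (κ / (Q - s * p') * R ^ (Q - s * p')) ^ (1 / p') := by
  have hρ := h.measurable
  have hpos : ∀ᵐ x ∂μ.restrict {x | ρ x < R}, 0 < ρ x := ae_restrict_of_ae h.ae_pos
  have h1 := ENNReal.lintegral_mul_le_Lp_mul_Lq (μ.restrict {x | ρ x < R}) hp
    (f := fun x => g x * ENNReal.ofReal (ρ x ^ s)) (g := fun x => ENNReal.ofReal (ρ x ^ (-s)))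
    (by fun_prop) (by fun_prop)
  refine le_trans (le_of_eq (lintegral_congr_ae ?_)) (h1.trans (le_of_eq ?_))
  · filter_upwards [hpos] with x hx
    simp only [Pi.mul_apply]
    rw [mul_assoc, ← ENNReal.ofReal_mul (by positivity), ← Real.rpow_add hx]
    simp
  · congr 2
    · refine lintegral_congr_ae ?_
      filter_upwards [hpos] with x hx
      rw [ENNReal.mul_rpow_of_nonneg _ _ hp.nonneg,
        ENNReal.ofReal_rpow_of_nonneg (by positivity) hp.nonneg, ← Real.rpow_mul hx.le]
    · have h2 := h.setLIntegral_lt_rpow (a := -(s * p')) (R := R) (by linarith) hR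
      rw [show -(s * p') + Q = Q - s * p' by ring] at h2
      rw [← h2]
      refine lintegral_congr_ae ?_
      filter_upwards [hpos] with x hx
      rw [ENNReal.ofReal_rpow_of_nonneg (by positivity) hp.symm.nonneg, ← Real.rpow_mul hx.le,
        neg_mul]

theorem exists_setLIntegral_le (h : IsPolar μ ρ Q κ) {p p' : ℝ} (hp : p.HolderConjugate p') {β : ℝ}
    (hβ : 0 < β * (1 - p') + Q) : ∃ K : ℝ≥0∞, K ≠ ⊤ ∧ ∀ g : X → ℝ≥0∞, Measurable g →
      ∀ R : ℝ, 0 < R → ∫⁻ x in {x | ρ x < R}, g x ∂μ ≤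
        K * (∫⁻ x, g x ^ p * ENNReal.ofReal (ρ x ^ β) ∂μ) ^ (1 / p) *
          ENNReal.ofReal (R ^ ((β * (1 - p') + Q) / p')) := by
  have hκ := h.const_pos
  have hp0 := hp.pos
  have hp'0 := hp.symm.pos
  have e1 : Q - β / p * p' = β * (1 - p') + Q := by
    have : p' / p = p' - 1 := hp.symm.div_conj_eq_sub_one
    rw [div_mul_eq_mul_div, mul_div_assoc, this]
    ring
  refine ⟨ENNReal.ofReal (κ / (β * (1 - p') + Q)) ^ (1 / p'),
    ENNReal.rpow_ne_top_of_nonneg (by positivity) ENNReal.ofReal_ne_top, fun g hg R hR => ?_⟩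
  have h1 := h.setLIntegral_le_weighted hp (s := β / p) (by rwa [e1]) hR hg
  rw [e1, div_mul_cancel₀ _ hp0.ne', ENNReal.ofReal_mul (by positivity),
    ENNReal.mul_rpow_of_nonneg _ _ (by positivity),
    ENNReal.ofReal_rpow_of_nonneg (Real.rpow_nonneg hR.le _) (by positivity),
    ← Real.rpow_mul hR.le, mul_one_div] at h1
  refine h1.trans ?_
  rw [← mul_assoc]
  gcongr ?_ * _
  rw [mul_comm]
  gcongr
  exact Measure.restrict_le_self

theorem measurable_setLIntegral_lt (g : X → ℝ≥0∞) :
    Measurable fun r : ℝ => ∫⁻ x in {x | ρ x < r}, g x ∂μ :=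
  Monotone.measurable fun _ _ hrs =>
    lintegral_mono_set fun _ hx => lt_of_lt_of_le hx hrs

/-- A Schur-type argument: weighted Hölder on the inner integral, Tonelli, then the explicit tail
integral of a power of `ρ`. -/
theorem exists_hardy (h : IsPolar μ ρ Q κ)
    [SFinite μ] {p p' : ℝ} (hp : p.HolderConjugate p') {β : ℝ}
    (hβ : 0 < β * (1 - p') + Q) : ∃ K : ℝ≥0∞, K ≠ ⊤ ∧ ∀ g : X → ℝ≥0∞, Measurable g →
      ∫⁻ x, (∫⁻ y in {y | ρ y < ρ x}, g y ∂μ) ^ p *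
        ENNReal.ofReal (ρ x ^ (-((p - 1) * (β * (1 - p') + Q)) - Q)) ∂μ ≤
      K * ∫⁻ x, g x ^ p * ENNReal.ofReal (ρ x ^ β) ∂μ := by
  have hκ := h.const_pos
  have hρ := h.measurable
  have hp0 := hp.pos
  have hp1 : 0 < p - 1 := hp.sub_one_pos
  have hp'0 := hp.symm.pos
  set D := β * (1 - p') + Q with hD
  have hpp : p / p' = p - 1 := hp.div_conj_eq_sub_one
  have hconj : (p - 1) * (p' - 1) = 1 := by
    have := hp.mul_eq_add
    linarith
  set s := (Q - D / 2) / p' with hs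
  have e1 : Q - s * p' = D / 2 := by rw [hs, div_mul_cancel₀ _ hp'0.ne']; ring
  have e2 : s * p = (p - 1) * (Q - D / 2) := by rw [hs, ← hpp]; ring
  set b := -((p - 1) * (D / 2)) - Q with hb
  have hbQ : b + Q = -((p - 1) * (D / 2)) := by rw [hb]; ring
  set K₁ := ENNReal.ofReal ((κ / (D / 2)) ^ (p - 1)) with hK₁
  set K₂ := ENNReal.ofReal (κ / ((p - 1) * (D / 2))) with hK₂
  refine ⟨K₁ * K₂, by finiteness, fun g hg => ?_⟩
  have step1 : ∀ x, 0 < ρ x → (∫⁻ y in {y | ρ y < ρ x}, g y ∂μ) ^ p *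
      ENNReal.ofReal (ρ x ^ (-((p - 1) * D) - Q)) ≤
      K₁ * ∫⁻ y, {y | ρ y < ρ x}.indicator
        (fun y => g y ^ p * ENNReal.ofReal (ρ y ^ (s * p))) y * ENNReal.ofReal (ρ x ^ b) ∂μ := by
    intro x hx
    have h1 := ENNReal.rpow_le_rpow
      (h.setLIntegral_le_weighted hp (s := s) (by rw [e1]; positivity) hx hg) hp0.le
    rw [e1, ENNReal.mul_rpow_of_nonneg _ _ hp0.le, ← ENNReal.rpow_mul, ← ENNReal.rpow_mul,
      one_div_mul_cancel hp0.ne', ENNReal.rpow_one, one_div_mul_eq_div, hpp,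
      ENNReal.ofReal_rpow_of_nonneg (by positivity) hp1.le,
      Real.mul_rpow (by positivity) (by positivity), ← Real.rpow_mul hx.le,
      ENNReal.ofReal_mul (by positivity), ← hK₁] at h1
    rw [lintegral_mul_const _ ((by fun_prop : Measurable
      fun y => g y ^ p * ENNReal.ofReal (ρ y ^ (s * p))).indicator
        (measurableSet_lt hρ measurable_const)),
      lintegral_indicator (measurableSet_lt hρ measurable_const)]
    refine (mul_le_mul_left h1 _).trans (le_of_eq ?_)
    have e3 : ρ x ^ b = ρ x ^ (D / 2 * (p - 1)) * ρ x ^ (-((p - 1) * D) - Q) := by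
      rw [← Real.rpow_add hx, hb]
      ring_nf
    rw [e3, ENNReal.ofReal_mul (by positivity)]
    ring
  calc _ ≤ ∫⁻ x, K₁ * ∫⁻ y, {y | ρ y < ρ x}.indicator
        (fun y => g y ^ p * ENNReal.ofReal (ρ y ^ (s * p))) y * ENNReal.ofReal (ρ x ^ b) ∂μ ∂μ :=
        lintegral_mono_ae (h.ae_pos.mono step1)
    _ = K₁ * ∫⁻ x, ∫⁻ y, {y | ρ y < ρ x}.indicator
        (fun y => g y ^ p * ENNReal.ofReal (ρ y ^ (s * p))) y * ENNReal.ofReal (ρ x ^ b) ∂μ ∂μ :=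
        lintegral_const_mul' _ _ (by finiteness)
    _ = K₁ * ∫⁻ y, ∫⁻ x, {y | ρ y < ρ x}.indicator
        (fun y => g y ^ p * ENNReal.ofReal (ρ y ^ (s * p))) y * ENNReal.ofReal (ρ x ^ b) ∂μ ∂μ := by
        rw [lintegral_lintegral_swap]
        refine Measurable.aemeasurable (Measurable.mul ?_ (by fun_prop))
        have hm : Measurable fun z : X × X => g z.2 ^ p * ENNReal.ofReal (ρ z.2 ^ (s * p)) := by
          fun_prop
        exact hm.indicator (measurableSet_lt (hρ.comp measurable_snd) (hρ.comp measurable_fst))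
    _ = K₁ * ∫⁻ y, K₂ * (g y ^ p * ENNReal.ofReal (ρ y ^ β)) ∂μ := by
        congr 1
        refine lintegral_congr_ae ?_
        filter_upwards [h.ae_pos] with y hy
        have h2 : ∀ x, {y | ρ y < ρ x}.indicator
            (fun y => g y ^ p * ENNReal.ofReal (ρ y ^ (s * p))) y * ENNReal.ofReal (ρ x ^ b) =
            (g y ^ p * ENNReal.ofReal (ρ y ^ (s * p))) *
              {x | ρ y < ρ x}.indicator (fun x => ENNReal.ofReal (ρ x ^ b)) x := by
          intro x
          by_cases hxy : ρ y < ρ x <;> simp [hxy]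
        have hms : MeasurableSet {x | ρ y < ρ x} := measurableSet_lt measurable_const hρ
        simp_rw [h2]
        rw [lintegral_const_mul _ ((by fun_prop : Measurable
          fun x => ENNReal.ofReal (ρ x ^ b)).indicator hms), lintegral_indicator hms,
          h.setLIntegral_gt_rpow (by rw [hbQ]; nlinarith [mul_pos hp1 hβ]) hy, hbQ, neg_neg,
          ENNReal.ofReal_mul (by positivity), ← hK₂]
        have e4 : ρ y ^ β = ρ y ^ (s * p) * ρ y ^ (-((p - 1) * (D / 2))) := by
          rw [← Real.rpow_add hy, e2]
          congr 1
          rw [hD]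
          linear_combination (-β) * hconj
        rw [e4, ENNReal.ofReal_mul (by positivity)]
        ring
    _ = _ := by rw [lintegral_const_mul' _ _ (by finiteness), mul_assoc]

/-- Growth bounds absorb `F₁ ^ (q - p₁)` and `F₂ ^ q`; only `F₁ ^ p₁` is left to integrate. -/
theorem exists_bilinear_hardy (h : IsPolar μ ρ Q κ) [SFinite μ] {p₁ p₁' p₂ p₂' q α β₁ β₂ : ℝ}
    (hp₁ : p₁.HolderConjugate p₁') (hp₂ : p₂.HolderConjugate p₂') (hq : p₁ ≤ q)
    (hβ₁ : 0 < β₁ * (1 - p₁') + Q) (hβ₂ : 0 < β₂ * (1 - p₂') + Q)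
    (hbal : (α + Q) / q + (β₁ * (1 - p₁') + Q) / p₁' + (β₂ * (1 - p₂') + Q) / p₂' = 0) :
    ∃ K : ℝ≥0∞, K ≠ ⊤ ∧ ∀ g₁ g₂ : X → ℝ≥0∞, Measurable g₁ → Measurable g₂ →
      (∫⁻ x, ((∫⁻ y in {y | ρ y < ρ x}, g₁ y ∂μ) * ∫⁻ y in {y | ρ y < ρ x}, g₂ y ∂μ) ^ q *
        ENNReal.ofReal (ρ x ^ α) ∂μ) ^ (1 / q) ≤
      K * ((∫⁻ x, g₁ x ^ p₁ * ENNReal.ofReal (ρ x ^ β₁) ∂μ) ^ (1 / p₁) *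
        (∫⁻ x, g₂ x ^ p₂ * ENNReal.ofReal (ρ x ^ β₂) ∂μ) ^ (1 / p₂)) := by
  obtain ⟨K₀, hK₀, H₀⟩ := h.exists_hardy hp₁ hβ₁
  obtain ⟨K₁, hK₁, H₁⟩ := h.exists_setLIntegral_le hp₁ hβ₁
  obtain ⟨K₂, hK₂, H₂⟩ := h.exists_setLIntegral_le hp₂ hβ₂
  have hp₁0 := hp₁.pos
  have hq0 : 0 < q := hp₁0.trans_le hq
  have hqp : 0 ≤ q - p₁ := sub_nonneg.2 hq
  set D₁ := β₁ * (1 - p₁') + Q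
  set D₂ := β₂ * (1 - p₂') + Q
  have e1 : p₁ * (D₁ / p₁') = (p₁ - 1) * D₁ := by
    rw [← hp₁.div_conj_eq_sub_one]; ring
  have eα : α + Q = -(q * (D₁ / p₁')) - q * (D₂ / p₂') := by
    have : α + Q = q * ((α + Q) / q) := by field_simp
    rw [this]
    linear_combination q * hbal
  refine ⟨(K₁ ^ (q - p₁) * K₂ ^ q * K₀) ^ (1 / q), by
    refine ENNReal.rpow_ne_top_of_nonneg (by positivity) (ENNReal.mul_ne_top
      (ENNReal.mul_ne_top ?_ ?_) hK₀)
    exacts [ENNReal.rpow_ne_top_of_nonneg hqp hK₁, ENNReal.rpow_ne_top_of_nonneg hq0.le hK₂],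
    fun g₁ g₂ hg₁ hg₂ => ?_⟩
  set N₁ := (∫⁻ x, g₁ x ^ p₁ * ENNReal.ofReal (ρ x ^ β₁) ∂μ) ^ (1 / p₁) with hN₁
  set N₂ := (∫⁻ x, g₂ x ^ p₂ * ENNReal.ofReal (ρ x ^ β₂) ∂μ) ^ (1 / p₂)
  have hN₁p : ∫⁻ x, g₁ x ^ p₁ * ENNReal.ofReal (ρ x ^ β₁) ∂μ = N₁ ^ p₁ := by
    rw [hN₁, ← ENNReal.rpow_mul, one_div_mul_cancel hp₁0.ne', ENNReal.rpow_one]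
  set c := (K₁ * N₁) ^ (q - p₁) * (K₂ * N₂) ^ q with hc
  have hmeas : Measurable fun x => (∫⁻ y in {y | ρ y < ρ x}, g₁ y ∂μ) ^ p₁ *
      ENNReal.ofReal (ρ x ^ (-((p₁ - 1) * D₁) - Q)) := by
    have hρ := h.measurable
    have := (measurable_setLIntegral_lt (μ := μ) (ρ := ρ) g₁).comp hρ
    exact (this.pow_const _).mul (by fun_prop)
  have key : ∫⁻ x, ((∫⁻ y in {y | ρ y < ρ x}, g₁ y ∂μ) *
      ∫⁻ y in {y | ρ y < ρ x}, g₂ y ∂μ) ^ q * ENNReal.ofReal (ρ x ^ α) ∂μ ≤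
      K₁ ^ (q - p₁) * K₂ ^ q * K₀ * (N₁ * N₂) ^ q := by
    calc _ ≤ ∫⁻ x, c * ((∫⁻ y in {y | ρ y < ρ x}, g₁ y ∂μ) ^ p₁ *
          ENNReal.ofReal (ρ x ^ (-((p₁ - 1) * D₁) - Q))) ∂μ := by
          refine lintegral_mono_ae ?_
          filter_upwards [h.ae_pos] with x hx
          set F₁ := ∫⁻ y in {y | ρ y < ρ x}, g₁ y ∂μ
          have b1 : F₁ ^ (q - p₁) ≤ (K₁ * N₁) ^ (q - p₁) *
              ENNReal.ofReal (ρ x ^ (D₁ / p₁' * (q - p₁))) := by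
            rw [Real.rpow_mul hx.le, ← ENNReal.ofReal_rpow_of_nonneg (by positivity) hqp,
              ← ENNReal.mul_rpow_of_nonneg _ _ hqp]
            exact ENNReal.rpow_le_rpow (H₁ g₁ hg₁ _ hx) hqp
          have b2 : (∫⁻ y in {y | ρ y < ρ x}, g₂ y ∂μ) ^ q ≤ (K₂ * N₂) ^ q *
              ENNReal.ofReal (ρ x ^ (D₂ / p₂' * q)) := by
            rw [Real.rpow_mul hx.le, ← ENNReal.ofReal_rpow_of_nonneg (by positivity) hq0.le,
              ← ENNReal.mul_rpow_of_nonneg _ _ hq0.le]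
            exact ENNReal.rpow_le_rpow (H₂ g₂ hg₂ _ hx) hq0.le
          have b3 : F₁ ^ q = F₁ ^ (q - p₁) * F₁ ^ p₁ := by
            rw [← ENNReal.rpow_add_of_nonneg _ _ hqp hp₁0.le, sub_add_cancel]
          -- The balance condition enters here, through `eα`.
          have e2 : ρ x ^ (-((p₁ - 1) * D₁) - Q) =
              ρ x ^ (D₁ / p₁' * (q - p₁)) * ρ x ^ (D₂ / p₂' * q) * ρ x ^ α := by
            rw [← Real.rpow_add hx, ← Real.rpow_add hx]
            congr 1
            linear_combination e1 - eα
          rw [ENNReal.mul_rpow_of_nonneg _ _ hq0.le, b3, e2, ENNReal.ofReal_mul (by positivity),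
            ENNReal.ofReal_mul (by positivity), hc]
          calc _ ≤ ((K₁ * N₁) ^ (q - p₁) * ENNReal.ofReal (ρ x ^ (D₁ / p₁' * (q - p₁)))) *
                F₁ ^ p₁ * ((K₂ * N₂) ^ q * ENNReal.ofReal (ρ x ^ (D₂ / p₂' * q))) *
                ENNReal.ofReal (ρ x ^ α) := by gcongr
            _ = _ := by ring
      _ = c * ∫⁻ x, (∫⁻ y in {y | ρ y < ρ x}, g₁ y ∂μ) ^ p₁ *
          ENNReal.ofReal (ρ x ^ (-((p₁ - 1) * D₁) - Q)) ∂μ := lintegral_const_mul _ hmeas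
      _ ≤ c * (K₀ * N₁ ^ p₁) := by
          rw [← hN₁p]
          gcongr
          exact H₀ g₁ hg₁
      _ = _ := by
          have : N₁ ^ q = N₁ ^ (q - p₁) * N₁ ^ p₁ := by
            rw [← ENNReal.rpow_add_of_nonneg _ _ hqp hp₁0.le, sub_add_cancel]
          rw [hc, ENNReal.mul_rpow_of_nonneg _ _ hqp, ENNReal.mul_rpow_of_nonneg _ _ hq0.le,
            ENNReal.mul_rpow_of_nonneg _ _ hq0.le, this]
          ring
  have h1q : 0 ≤ 1 / q := by positivity
  refine (ENNReal.rpow_le_rpow key h1q).trans (le_of_eq ?_)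
  rw [ENNReal.mul_rpow_of_nonneg _ _ h1q, ← ENNReal.rpow_mul (N₁ * N₂),
    mul_one_div_cancel hq0.ne', ENNReal.rpow_one]

end IsPolar

/-! ### Necessity: power test functions -/

namespace IsPolar

variable {X : Type*} [MeasurableSpace X] {μ : Measure X} {ρ : X → ℝ} {Q κ : ℝ}

/-- The function equal to `ρ ^ a` on `A` and to zero elsewhere. -/
noncomputable def powerOn (ρ : X → ℝ) (a : ℝ) (A : Set X) : X → ℂ :=
  A.indicator fun x => ((ρ x ^ a : ℝ) : ℂ)

theorem measurable_powerOn (h : IsPolar μ ρ Q κ) (a : ℝ) {A : Set X} (hA : MeasurableSet A) :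
    Measurable (powerOn ρ a A) := by
  have := h.measurable
  exact (by fun_prop : Measurable fun x => ((ρ x ^ a : ℝ) : ℂ)).indicator hA

theorem lintegral_powerOn (h : IsPolar μ ρ Q κ) {a p β : ℝ} (hp : 0 < p) (hβ : a * p + β = a)
    {A : Set X} (hA : MeasurableSet A) :
    ∫⁻ x, ‖powerOn ρ a A x‖ₑ ^ p * ENNReal.ofReal (ρ x ^ β) ∂μ =
      ∫⁻ x in A, ENNReal.ofReal (ρ x ^ a) ∂μ := by
  rw [← lintegral_indicator hA]
  refine lintegral_congr_ae ?_
  filter_upwards [h.ae_pos] with x hx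
  by_cases hxA : x ∈ A
  · simp only [powerOn, hxA, indicator_of_mem]
    rw [← ofReal_norm, Complex.norm_real, Real.norm_of_nonneg (by positivity),
      ENNReal.ofReal_rpow_of_nonneg (by positivity) hp.le, ← ENNReal.ofReal_mul (by positivity),
      ← Real.rpow_mul hx.le, ← Real.rpow_add hx, hβ]
  · simp [powerOn, hxA, hp]

/-- Finiteness is essential: otherwise the Bochner integral takes its default value `0`. -/
theorem enorm_setIntegral_powerOn (h : IsPolar μ ρ Q κ) (a : ℝ) {A B : Set X}
    (hA : MeasurableSet A) (hAB : A ⊆ B) (hfin : ∫⁻ x in A, ENNReal.ofReal (ρ x ^ a) ∂μ ≠ ⊤) :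
    ‖∫ x in B, powerOn ρ a A x ∂μ‖ₑ = ∫⁻ x in A, ENNReal.ofReal (ρ x ^ a) ∂μ := by
  have hρ := h.measurable
  have h0 : 0 ≤ᵐ[μ.restrict A] fun x => ρ x ^ a :=
    ae_restrict_of_ae (h.ae_pos.mono fun x hx => Real.rpow_nonneg hx.le a)
  rw [powerOn, integral_indicator hA, Measure.restrict_restrict hA, inter_eq_left.2 hAB,
    integral_complex_ofReal, ← ofReal_norm, Complex.norm_real,
    Real.norm_of_nonneg (integral_nonneg_of_ae h0),
    ofReal_integral_eq_lintegral_ofReal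
      ((lintegral_ofReal_ne_top_iff_integrable (hρ.pow_const a).aestronglyMeasurable h0).1 hfin) h0]

/-- The bilinear weighted Hardy inequality. -/
def HardyBound (μ : Measure X) (ρ : X → ℝ) (p₁ p₂ q α β₁ β₂ : ℝ) (C : ℝ≥0∞) : Prop :=
  ∀ f₁ f₂ : X → ℂ, Measurable f₁ → Measurable f₂ →
    (∫⁻ x, ‖(∫ y in {y | ρ y < ρ x}, f₁ y ∂μ) * ∫ y in {y | ρ y < ρ x}, f₂ y ∂μ‖ₑ ^ q *
      ENNReal.ofReal (ρ x ^ α) ∂μ) ^ (1 / q) ≤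
    C * ((∫⁻ x, ‖f₁ x‖ₑ ^ p₁ * ENNReal.ofReal (ρ x ^ β₁) ∂μ) ^ (1 / p₁) *
      (∫⁻ x, ‖f₂ x‖ₑ ^ p₂ * ENNReal.ofReal (ρ x ^ β₂) ∂μ) ^ (1 / p₂))

/-- With `a = β * (1 - p')` one has `(ρ ^ a) ^ p * ρ ^ β = ρ ^ a`, so the integral of the test
function and its weighted norm are governed by the same quantity. -/
theorem _root_.Real.HolderConjugate.weight_exponent {p p' : ℝ} (hp : p.HolderConjugate p')
    (β : ℝ) : β * (1 - p') * p + β = β * (1 - p') := by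
  linear_combination (-β) * hp.mul_eq_add

theorem _root_.ENNReal.rpow_conj_mul {p p' : ℝ} (hp : p.HolderConjugate p') (T : ℝ≥0∞) :
    T = T ^ (1 / p) * T ^ (1 / p') := by
  have h1 := hp.pos
  have h2 := hp.symm.pos
  rw [← ENNReal.rpow_add_of_nonneg _ _ (by positivity) (by positivity), one_div, one_div,
    hp.inv_add_inv_eq_one, ENNReal.rpow_one]

section necessity

variable {p₁ p₁' p₂ p₂' q α β₁ β₂ : ℝ} {C : ℝ≥0∞}

/-- For `ρ x > R` both inner integrals are the constants `T₁` and `T₂`. Restricting the left side to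
this region and dividing by `Tᵢ ^ (1 / pᵢ)` leaves the conjugate powers. -/
theorem HardyBound.test (hC : HardyBound μ ρ p₁ p₂ q α β₁ β₂ C) (h : IsPolar μ ρ Q κ)
    (hp₁ : p₁.HolderConjugate p₁') (hp₂ : p₂.HolderConjugate p₂') (hq : 0 < q)
    {A₁ A₂ : Set X} {R : ℝ} (hA₁ : MeasurableSet A₁) (hA₂ : MeasurableSet A₂)
    (hA₁R : A₁ ⊆ {x | ρ x < R}) (hA₂R : A₂ ⊆ {x | ρ x < R}) {T₁ T₂ : ℝ≥0∞}
    (e₁ : ∫⁻ x in A₁, ENNReal.ofReal (ρ x ^ (β₁ * (1 - p₁'))) ∂μ = T₁)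
    (e₂ : ∫⁻ x in A₂, ENNReal.ofReal (ρ x ^ (β₂ * (1 - p₂'))) ∂μ = T₂)
    (hT₁ : T₁ ≠ 0) (hT₁' : T₁ ≠ ⊤) (hT₂ : T₂ ≠ 0) (hT₂' : T₂ ≠ ⊤) :
    T₁ ^ (1 / p₁') * T₂ ^ (1 / p₂') *
      (∫⁻ x in {x | R < ρ x}, ENNReal.ofReal (ρ x ^ α) ∂μ) ^ (1 / q) ≤ C := by
  have hρ := h.measurable
  set W := ∫⁻ x in {x | R < ρ x}, ENNReal.ofReal (ρ x ^ α) ∂μ with hW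
  have h1 := hC _ _ (h.measurable_powerOn (β₁ * (1 - p₁')) hA₁)
    (h.measurable_powerOn (β₂ * (1 - p₂')) hA₂)
  rw [h.lintegral_powerOn hp₁.pos (hp₁.weight_exponent β₁) hA₁,
    h.lintegral_powerOn hp₂.pos (hp₂.weight_exponent β₂) hA₂, e₁, e₂] at h1
  have h2 : (T₁ * T₂) * W ^ (1 / q) ≤ C * (T₁ ^ (1 / p₁) * T₂ ^ (1 / p₂)) := by
    refine le_trans ?_ h1
    have h3 : T₁ * T₂ = ((T₁ * T₂) ^ q) ^ (1 / q) := by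
      rw [← ENNReal.rpow_mul, mul_one_div_cancel hq.ne', ENNReal.rpow_one]
    rw [h3, ← ENNReal.mul_rpow_of_nonneg _ _ (by positivity)]
    refine ENNReal.rpow_le_rpow ?_ (by positivity)
    rw [hW, ← lintegral_const_mul _ (by fun_prop)]
    refine le_trans (le_of_eq ?_) (setLIntegral_le_lintegral {x | R < ρ x} _)
    refine setLIntegral_congr_fun (measurableSet_lt measurable_const hρ) fun x hx => ?_
    have hx' : {y | ρ y < R} ⊆ {y | ρ y < ρ x} := fun y (hy : ρ y < R) => hy.trans hx
    rw [enorm_mul, h.enorm_setIntegral_powerOn _ hA₁ (hA₁R.trans hx') (e₁ ▸ hT₁'),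
      h.enorm_setIntegral_powerOn _ hA₂ (hA₂R.trans hx') (e₂ ▸ hT₂'), e₁, e₂]
  have h4 : T₁ ^ (1 / p₁) * T₂ ^ (1 / p₂) ≠ 0 :=
    mul_ne_zero (ENNReal.rpow_pos (pos_iff_ne_zero.2 hT₁) hT₁').ne'
      (ENNReal.rpow_pos (pos_iff_ne_zero.2 hT₂) hT₂').ne'
  have h5 : T₁ ^ (1 / p₁) * T₂ ^ (1 / p₂) ≠ ⊤ :=
    ENNReal.mul_ne_top (ENNReal.rpow_ne_top_of_ne_zero hT₁ hT₁')
      (ENNReal.rpow_ne_top_of_ne_zero hT₂ hT₂')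
  refine (ENNReal.mul_le_mul_iff_left h4 h5).1 (le_trans (le_of_eq ?_) h2)
  conv_rhs => rw [ENNReal.rpow_conj_mul hp₁ T₁, ENNReal.rpow_conj_mul hp₂ T₂]
  ring

theorem measurableSet_shell (h : IsPolar μ ρ Q κ) (ε R : ℝ) :
    MeasurableSet (ρ ⁻¹' Ioo ε R) := h.measurable measurableSet_Ioo

theorem HardyBound.alpha_neg (hC : HardyBound μ ρ p₁ p₂ q α β₁ β₂ C) (h : IsPolar μ ρ Q κ)
    (hCt : C ≠ ⊤) (hp₁ : p₁.HolderConjugate p₁') (hp₂ : p₂.HolderConjugate p₂') (hq : 0 < q) :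
    α + Q < 0 := by
  refine h.neg_of_setLIntegral_ne_top one_pos fun hW => hCt (top_le_iff.1 ?_)
  have z₁ := h.setLIntegral_shell_ne_zero (β₁ * (1 - p₁')) one_half_pos (one_half_lt_one)
  have z₂ := h.setLIntegral_shell_ne_zero (β₂ * (1 - p₂')) one_half_pos (one_half_lt_one)
  have t₁ := h.setLIntegral_shell_ne_top (β₁ * (1 - p₁')) one_half_pos 1
  have t₂ := h.setLIntegral_shell_ne_top (β₂ * (1 - p₂')) one_half_pos 1
  refine le_trans (le_of_eq ?_) (hC.test h hp₁ hp₂ hq (R := 1) (h.measurableSet_shell (1 / 2) 1)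
    (h.measurableSet_shell (1 / 2) 1) (fun x hx => hx.2) (fun x hx => hx.2) rfl rfl z₁ t₁ z₂ t₂)
  rw [hW, ENNReal.top_rpow_of_pos (by positivity), ENNReal.mul_top]
  exact mul_ne_zero (ENNReal.rpow_pos (pos_iff_ne_zero.2 z₁) t₁).ne'
      (ENNReal.rpow_pos (pos_iff_ne_zero.2 z₂) t₂).ne'

/-- Shells with outer radius `1` and shrinking inner radius satisfy a uniform bound, so by monotone
convergence the integral over the unit ball is finite. -/
theorem HardyBound.beta_pos (hC : HardyBound μ ρ p₁ p₂ q α β₁ β₂ C) (h : IsPolar μ ρ Q κ)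
    (hCt : C ≠ ⊤) (hp₁ : p₁.HolderConjugate p₁') (hp₂ : p₂.HolderConjugate p₂') (hq : 0 < q) :
    0 < β₁ * (1 - p₁') + Q := by
  have hα := hC.alpha_neg h hCt hp₁ hp₂ hq
  have hκ := h.const_pos
  have hp₁'0 := hp₁.symm.pos
  set W := ∫⁻ x in {x | 1 < ρ x}, ENNReal.ofReal (ρ x ^ α) ∂μ with hW
  have hW0 : W ≠ 0 ∧ W ≠ ⊤ := by
    rw [hW, h.setLIntegral_gt_rpow hα one_pos]
    refine ⟨?_, ENNReal.ofReal_ne_top⟩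
    have : 0 < -(α + Q) := by linarith
    simp only [Real.one_rpow, mul_one, ne_eq, ENNReal.ofReal_eq_zero, not_le]
    positivity
  have z₂ := h.setLIntegral_shell_ne_zero (β₂ * (1 - p₂')) one_half_pos (one_half_lt_one)
  have t₂ := h.setLIntegral_shell_ne_top (β₂ * (1 - p₂')) one_half_pos 1
  set T₂ := ∫⁻ x in ρ ⁻¹' Ioo (1 / 2) 1, ENNReal.ofReal (ρ x ^ (β₂ * (1 - p₂'))) ∂μ
  set c := T₂ ^ (1 / p₂') * W ^ (1 / q) with hc
  have hc0 : c ≠ 0 := mul_ne_zero (ENNReal.rpow_pos (pos_iff_ne_zero.2 z₂) t₂).ne'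
    (ENNReal.rpow_pos (pos_iff_ne_zero.2 hW0.1) hW0.2).ne'
  have hct : c ≠ ⊤ := ENNReal.mul_ne_top (ENNReal.rpow_ne_top_of_ne_zero z₂ t₂)
    (ENNReal.rpow_ne_top_of_ne_zero hW0.1 hW0.2)
  -- The `+ 2` keeps the inner radius below `1` already for `n = 0`.
  have bound : ∀ n : ℕ, ∫⁻ x in ρ ⁻¹' Ioo (1 / ((n : ℝ) + 2)) 1,
      ENNReal.ofReal (ρ x ^ (β₁ * (1 - p₁'))) ∂μ ≤ (C / c) ^ p₁' := by
    intro n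
    have hn : (0 : ℝ) < 1 / ((n : ℝ) + 2) := by positivity
    have hn1 : 1 / ((n : ℝ) + 2) < 1 := by
      rw [div_lt_one (by positivity)]
      linarith [(Nat.cast_nonneg n : (0 : ℝ) ≤ n)]
    have z₁ := h.setLIntegral_shell_ne_zero (β₁ * (1 - p₁')) hn hn1
    have t₁ := h.setLIntegral_shell_ne_top (β₁ * (1 - p₁')) hn 1
    have := hC.test h hp₁ hp₂ hq (R := 1) (h.measurableSet_shell _ 1)
      (h.measurableSet_shell (1 / 2) 1) (fun x hx => hx.2) (fun x hx => hx.2) rfl rfl z₁ t₁ z₂ t₂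
    rw [mul_assoc, ← hW, ← hc] at this
    have := ENNReal.rpow_le_rpow ((ENNReal.le_div_iff_mul_le (Or.inl hc0) (Or.inl hct)).2 this)
      hp₁'0.le
    rwa [← ENNReal.rpow_mul, one_div_mul_cancel hp₁'0.ne', ENNReal.rpow_one] at this
  refine h.pos_of_setLIntegral_ne_top one_pos (ne_top_of_le_ne_top
    (ENNReal.rpow_ne_top_of_nonneg hp₁'0.le (ENNReal.div_ne_top hCt hc0))
    ?_)
  -- The shells miss only `ρ ≤ 0`, a null set.
  have hU : ({x | ρ x < 1} : Set X) ≤ᵐ[μ]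
      (⋃ n : ℕ, ρ ⁻¹' Ioo (1 / ((n : ℝ) + 2)) 1 : Set X) := by
    filter_upwards [h.ae_pos] with x hx hx1
    obtain ⟨n, hn⟩ := exists_nat_one_div_lt hx
    refine mem_iUnion.2 ⟨n, lt_of_le_of_lt ?_ hn, hx1⟩
    gcongr
    norm_num
  refine (lintegral_mono' (Measure.restrict_mono_ae hU) le_rfl).trans ?_
  rw [setLIntegral_iUnion_of_directed]
  · exact iSup_le bound
  · refine Monotone.directed_le fun m n hmn => preimage_mono (Ioo_subset_Ioo_left ?_)
    gcongr

theorem HardyBound.symm (hC : HardyBound μ ρ p₁ p₂ q α β₁ β₂ C) :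
    HardyBound μ ρ p₂ p₁ q α β₂ β₁ C := fun f₁ f₂ hf₁ hf₂ => by
  have := hC f₂ f₁ hf₂ hf₁
  simp_rw [mul_comm (∫ y in _, f₁ y ∂μ)]
  rwa [mul_comm (_ ^ (1 / p₂))]

/-- The sign conditions now make full balls admissible in `HardyBound.test`; every integral is an
exact power of `R`, with total exponent the quantity in question. -/
theorem HardyBound.balance (hC : HardyBound μ ρ p₁ p₂ q α β₁ β₂ C) (h : IsPolar μ ρ Q κ)
    (hCt : C ≠ ⊤) (hp₁ : p₁.HolderConjugate p₁') (hp₂ : p₂.HolderConjugate p₂') (hq : 0 < q) :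
    (α + Q) / q + (β₁ * (1 - p₁') + Q) / p₁' + (β₂ * (1 - p₂') + Q) / p₂' = 0 := by
  have hα := hC.alpha_neg h hCt hp₁ hp₂ hq
  have hβ₁ := hC.beta_pos h hCt hp₁ hp₂ hq
  have hβ₂ := hC.symm.beta_pos h hCt hp₂ hp₁ hq
  have hκ := h.const_pos
  have hp₁'0 := hp₁.symm.pos
  have hp₂'0 := hp₂.symm.pos
  have hρ := h.measurable
  have hα' : 0 < -(α + Q) := by linarith
  set D₁ := β₁ * (1 - p₁') + Q
  set D₂ := β₂ * (1 - p₂') + Q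
  set k := (κ / D₁) ^ (1 / p₁') * (κ / D₂) ^ (1 / p₂') * (κ / -(α + Q)) ^ (1 / q) with hk
  have hk0 : 0 < k := by positivity
  refine eq_zero_of_forall_rpow_le (M := C.toReal / k) fun R hR => ?_
  have z : ∀ {a b : ℝ}, 0 < a → ENNReal.ofReal (a * R ^ b) ≠ 0 := fun ha => by
    simp only [ne_eq, ENNReal.ofReal_eq_zero, not_le]
    positivity
  have h1 := hC.test h hp₁ hp₂ hq (R := R) (measurableSet_lt hρ measurable_const)
    (measurableSet_lt hρ measurable_const) subset_rfl subset_rfl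
    (h.setLIntegral_lt_rpow hβ₁ hR) (h.setLIntegral_lt_rpow hβ₂ hR)
    (z (by positivity)) ENNReal.ofReal_ne_top (z (by positivity)) ENNReal.ofReal_ne_top
  rw [h.setLIntegral_gt_rpow hα hR, ENNReal.ofReal_rpow_of_nonneg (by positivity) (by positivity),
    ENNReal.ofReal_rpow_of_nonneg (by positivity) (by positivity),
    ENNReal.ofReal_rpow_of_nonneg (by positivity) (by positivity),
    ← ENNReal.ofReal_mul (by positivity), ← ENNReal.ofReal_mul (by positivity),
    ENNReal.ofReal_le_iff_le_toReal hCt] at h1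
  rw [le_div_iff₀ hk0]
  refine le_trans (le_of_eq ?_) h1
  rw [Real.mul_rpow (by positivity) (by positivity), Real.mul_rpow (by positivity) (by positivity),
    Real.mul_rpow (by positivity) (by positivity), ← Real.rpow_mul hR.le, ← Real.rpow_mul hR.le,
    ← Real.rpow_mul hR.le, Real.rpow_add hR, Real.rpow_add hR, hk]
  simp only [mul_one_div]
  ring

end necessity

/-! ### Complex-valued functions and absolute convergence -/

theorem exists_hardyBound [SFinite μ] (h : IsPolar μ ρ Q κ) {p₁ p₁' p₂ p₂' q α β₁ β₂ : ℝ}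
    (hp₁ : p₁.HolderConjugate p₁') (hp₂ : p₂.HolderConjugate p₂') (hq : p₁ ≤ q)
    (hβ₁ : 0 < β₁ * (1 - p₁') + Q) (hβ₂ : 0 < β₂ * (1 - p₂') + Q)
    (hbal : (α + Q) / q + (β₁ * (1 - p₁') + Q) / p₁' + (β₂ * (1 - p₂') + Q) / p₂' = 0) :
    ∃ C : ℝ≥0, HardyBound μ ρ p₁ p₂ q α β₁ β₂ C := by
  obtain ⟨K, hK, H⟩ := h.exists_bilinear_hardy hp₁ hp₂ hq hβ₁ hβ₂ hbal
  have hq0 : 0 < q := hp₁.pos.trans_le hq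
  refine ⟨K.toNNReal, fun f₁ f₂ hf₁ hf₂ => ?_⟩
  rw [ENNReal.coe_toNNReal hK]
  refine le_trans (ENNReal.rpow_le_rpow (lintegral_mono fun x => ?_) (by positivity))
    (H (fun x => ‖f₁ x‖ₑ) (fun x => ‖f₂ x‖ₑ) hf₁.enorm hf₂.enorm)
  rw [enorm_mul]
  gcongr <;> exact enorm_integral_le_lintegral_enorm _

theorem integrableOn_of_lintegral_ne_top (h : IsPolar μ ρ Q κ) {p p' β : ℝ}
    (hp : p.HolderConjugate p') (hβ : 0 < β * (1 - p') + Q) {f : X → ℂ} (hf : Measurable f)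
    (hfin : (∫⁻ x, ‖f x‖ₑ ^ p * ENNReal.ofReal (ρ x ^ β) ∂μ) ^ (1 / p) ≠ ⊤) (R : ℝ) :
    IntegrableOn f {x | ρ x < R} μ := by
  obtain ⟨K, hK, H⟩ := h.exists_setLIntegral_le hp hβ
  have hR : 0 < max R 1 := by positivity
  refine IntegrableOn.mono_set (t := {x | ρ x < max R 1}) ⟨hf.aestronglyMeasurable, ?_⟩
    fun x (hx : ρ x < R) => hx.trans_le (le_max_left _ _)
  refine (H (fun x => ‖f x‖ₑ) hf.enorm _ hR).trans_lt (lt_top_iff_ne_top.2 ?_)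
  exact ENNReal.mul_ne_top (ENNReal.mul_ne_top hK hfin) ENNReal.ofReal_ne_top

end IsPolar

/-! ### Polar form of Haar measure and conclusion -/

namespace HomogeneousStructure

variable {n : ℕ} {G : Type*} [Group G] [TopologicalSpace G]
  [ChartedSpace (EuclideanSpace ℝ (Fin n)) G] {S : HomogeneousStructure n G}

theorem homogeneousDim_pos (S : HomogeneousStructure n G) (hn : 0 < n) :
    0 < S.homogeneousDim :=
  Finset.sum_pos (fun i _ => S.weight_pos i) ⟨⟨0, hn⟩, Finset.mem_univ _⟩

/-- Both measures give `Iio b` the mass `v b ^ Q` for `b > 0` and `0` otherwise, where `v = μ (B(0,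
1))`; these half-lines form a generating π-system. Differentiating `v b ^ Q` gives `κ = v Q`. -/
theorem QuasiNorm.exists_isPolar [LieGroup 𝓘(ℝ, EuclideanSpace ℝ (Fin n)) ∞ G]
    [MeasurableSpace G] [BorelSpace G] (hn : 0 < n) (N : S.QuasiNorm) (μ : Measure G)
    [μ.IsHaarMeasure] : ∃ κ : ℝ, IsPolar μ N.val S.homogeneousDim κ := by
  have hQ := S.homogeneousDim_pos hn
  set Q := S.homogeneousDim with hQdef
  have hv : 0 < (μ (N.ball 1)).toReal :=
    ENNReal.toReal_pos (N.measure_ball_pos μ one_pos).ne' (N.measure_ball_ne_top μ 1)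
  set v := (μ (N.ball 1)).toReal with hvdef
  have hm : Measurable N.val := N.continuous_val.measurable
  have hIio : ∀ b : ℝ, μ.map N.val (Iio b) = μ (N.ball b) := fun b =>
    Measure.map_apply hm measurableSet_Iio
  refine ⟨v * Q, hm, hQ, by positivity, ?_⟩
  refine Measure.ext_of_generateFrom_of_iUnion (range Iio) (fun k : ℕ => Iio (k : ℝ))
    ((BorelSpace.measurable_eq).trans (borel_eq_generateFrom_Iio ℝ)) isPiSystem_Iio
    ?_ (fun k => mem_range_self _) (fun k => ?_) ?_
  · exact iUnion_eq_univ_iff.2 fun x => exists_nat_gt x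
  · rw [hIio]
    exact N.measure_ball_ne_top μ _
  · rintro _ ⟨b, rfl⟩
    rw [hIio, withDensity_apply _ measurableSet_Iio, Measure.restrict_restrict measurableSet_Iio,
      inter_comm, Ioi_inter_Iio]
    rcases le_or_gt b 0 with hb | hb
    · have : N.ball b = ∅ := eq_empty_of_forall_notMem fun x (hx : N.val x < b) =>
        ((N.nonneg x).trans_lt hx).not_ge hb
      rw [this, Ioo_eq_empty (not_lt.2 hb)]
      simp
    · have h1 := N.measure_ball_mul μ hb 1
      rw [mul_one, ← ENNReal.ofReal_toReal (N.measure_ball_ne_top μ 1), ← hvdef, ← hQdef,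
        ← ENNReal.ofReal_mul (by positivity)] at h1
      simp_rw [ENNReal.ofReal_mul (mul_nonneg hv.le hQ.le)]
      rw [h1, lintegral_const_mul _ (by fun_prop), lintegral_Ioo_rpow (by linarith) hb,
        ← ENNReal.ofReal_mul (by positivity), sub_add_cancel]
      congr 1
      field_simp

end HomogeneousStructure

end

theorem corollary5p1 {n : ℕ} (hn : 0 < n) {G : Type*} [Group G] [TopologicalSpace G]
    [ChartedSpace (EuclideanSpace ℝ (Fin n)) G]
    [LieGroup 𝓘(ℝ, EuclideanSpace ℝ (Fin n)) ∞ G]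
    [MeasurableSpace G] [BorelSpace G]
    (S : HomogeneousStructure n G) (N : S.QuasiNorm)
    (μ : Measure G) [μ.IsHaarMeasure]
    (p₁ p₂ q α β₁ β₂ : ℝ) (hp₁ : 1 < p₁) (hp₂ : 1 < p₂) (hq : max p₁ p₂ ≤ q) :
    ((∃ C : ℝ≥0, ∀ f₁ f₂ : G → ℂ, Measurable f₁ → Measurable f₂ →
        N.weightedNorm μ q α (N.bilinearHardy μ f₁ f₂) ≤
          C * (N.weightedNorm μ p₁ β₁ f₁ * N.weightedNorm μ p₂ β₂ f₂)) ↔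
      (α + S.homogeneousDim < 0 ∧
        0 < β₁ * (1 - p₁.conjExponent) + S.homogeneousDim ∧
        0 < β₂ * (1 - p₂.conjExponent) + S.homogeneousDim ∧
        (α + S.homogeneousDim) / q +
          (β₁ * (1 - p₁.conjExponent) + S.homogeneousDim) / p₁.conjExponent +
          (β₂ * (1 - p₂.conjExponent) + S.homogeneousDim) / p₂.conjExponent = 0)) ∧
    -- the integrals defining the bilinear operator converge absolutely under these conditions
    (0 < β₁ * (1 - p₁.conjExponent) + S.homogeneousDim →
      ∀ f : G → ℂ, Measurable f → N.weightedNorm μ p₁ β₁ f ≠ ⊤ →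
        ∀ r : ℝ, IntegrableOn f (N.ball r) μ) ∧
    (0 < β₂ * (1 - p₂.conjExponent) + S.homogeneousDim →
      ∀ f : G → ℂ, Measurable f → N.weightedNorm μ p₂ β₂ f ≠ ⊤ →
        ∀ r : ℝ, IntegrableOn f (N.ball r) μ) := by
  obtain ⟨κ, h⟩ := N.exists_isPolar hn μ
  -- With local compactness this makes `μ` σ-finite, as the Tonelli step of the Hardy inequality
  -- requires.
  have : SecondCountableTopology G := S.coord.toHomeomorph.secondCountableTopology
  have : LocallyCompactSpace G := S.coord.toHomeomorph.isClosedEmbedding.locallyCompactSpace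
  have h₁ := Real.HolderConjugate.conjExponent hp₁
  have h₂ := Real.HolderConjugate.conjExponent hp₂
  have hq₁ : p₁ ≤ q := (le_max_left _ _).trans hq
  have hq0 : 0 < q := h₁.pos.trans_le hq₁
  refine ⟨⟨?_, ?_⟩, fun hβ f hf hfin r => h.integrableOn_of_lintegral_ne_top h₁ hβ hf hfin r,
    fun hβ f hf hfin r => h.integrableOn_of_lintegral_ne_top h₂ hβ hf hfin r⟩
  · rintro ⟨C, hC⟩
    have hC' : IsPolar.HardyBound μ N.val p₁ p₂ q α β₁ β₂ C := hC
    exact ⟨hC'.alpha_neg h ENNReal.coe_ne_top h₁ h₂ hq0,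
      hC'.beta_pos h ENNReal.coe_ne_top h₁ h₂ hq0,
      hC'.symm.beta_pos h ENNReal.coe_ne_top h₂ h₁ hq0,
      hC'.balance h ENNReal.coe_ne_top h₁ h₂ hq0⟩
  · rintro ⟨-, hβ₁, hβ₂, hbal⟩
    exact h.exists_hardyBound h₁ h₂ hq₁ hβ₁ hβ₂ hbal
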